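/- Let $d\ge 1$, let $D\subseteq\mathbb{R}^d$, and let $f$ be a real-valued function that is $C^\infty$ on an open set containing $D$. Write $M^{(k)}_f(x)=\max_{|s|=k}|D^{s}f(x)|$ for the largest absolute value of a $k$-th order partial derivative of $f$ at $x$. Let $B\ge 0$ and $C\ge 1$ be integers and let $0<\beta_{\min}\le C$ be such that the well-behavedness bound $$M^{(k)}_f(x)\le C^k\,2^B\,\frac{k!}{\beta_{\min}^k}\qquad\text{for all } x\in D,\ k\in\mathbb{Z}_{\ge 0}$$ holds. Let $\delta,\varepsilon>0$, and suppose that $f$ is $\delta$-strongly non-degenerate in $D$, i.e. there is some $x^*\in D$ with $\nabla f(x^*)=0$ and $|\det\nabla^2 f(x^*)|\ge\delta$. Put $$\delta'=\frac{\delta}{2}\left(\frac{\beta_{\min}^2}{2dC^2 2^B}\right)^{d-1},\qquad \alpha=\min\left(\frac{\varepsilon}{\sqrt d},\ \frac{\delta'\beta_{\min}^3}{8d^2C^3 2^B}\right),\qquad \varepsilon'=\frac{3}{16}\,\delta'\alpha .$$ Let $x\in D$ be a point such that the cube $x+[-\alpha,\alpha]^d$ is contained in $D$ and such that $$\|\nabla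 f(x)\|_\infty\le\varepsilon'\qquad\text{and}\qquad |\det\nabla^2 f(x)|\ge\delta-\varepsilon'.$$ Then there exists $u\in\mathbb{R}^d$ with $x+u\in D$, $\nabla f(x+u)=0$ and $\|u\|_\infty\le\varepsilon/\sqrt d$; in particular $\|u\|_2\le\varepsilon$. -/

import Mathlib

open scoped ContDiff

/-- The iterated partial derivative `∂_{s 0} ⋯ ∂_{s (k-1)} f (x)` of order `k`. At a point near which
`f` is smooth the order of differentiation is immaterial, so this is `D^s f (x)` for the
multi-index that counts how often each coordinate occurs in `s`. -/
noncomputable def iteratedPartial {d k : ℕ} (f : EuclideanSpace ℝ (Fin d) → ℝ)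
    (s : Fin k → Fin d) (x : EuclideanSpace ℝ (Fin d)) : ℝ :=
  iteratedFDeriv ℝ k f x (fun i => EuclideanSpace.single (s i) 1)

/-- `M^{(k)}_f(x)`: the largest absolute value of a partial derivative of order `k` at `x`
(a supremum over a finite set of indices). -/
noncomputable def maxPartial {d : ℕ} (k : ℕ) (f : EuclideanSpace ℝ (Fin d) → ℝ)
    (x : EuclideanSpace ℝ (Fin d)) : ℝ :=
  ⨆ s : Fin k → Fin d, |iteratedPartial f s x|

/-- The Hessian matrix `∇² f (x)`. -/
noncomputable def hessianMatrix {d : ℕ} (f : EuclideanSpace ℝ (Fin d) → ℝ)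
    (x : EuclideanSpace ℝ (Fin d)) : Matrix (Fin d) (Fin d) ℝ :=
  Matrix.of fun i j => iteratedPartial f ![i, j] x

/-- `f` is smooth on an open set that contains the domain `D`. -/
def SmoothNear {d : ℕ} (f : EuclideanSpace ℝ (Fin d) → ℝ)
    (D : Set (EuclideanSpace ℝ (Fin d))) : Prop :=
  ∃ U : Set (EuclideanSpace ℝ (Fin d)), IsOpen U ∧ D ⊆ U ∧ ContDiffOn ℝ ∞ f U

/-- `B`, `C` and `βmin` are well-behavedness parameters of the smooth function `f` on the domain
`D`: all derivatives satisfy `M^{(k)}_f(x) ≤ C^k 2^B k! / βmin^k` on `D`.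

For a single function the remaining clauses of well-behavedness (sets of large derivatives can be
covered by few small boxes that can be computed efficiently, parameters polynomial in the length of
a representation) are not required, so this covers every member of every well-behaved family. -/
structure HasWellBehavedParams {d : ℕ} (f : EuclideanSpace ℝ (Fin d) → ℝ)
    (D : Set (EuclideanSpace ℝ (Fin d))) (B C : ℕ) (βmin : ℝ) : Prop where
  smooth : SmoothNear f D
  C_pos : 1 ≤ C
  βmin_pos : 0 < βmin
  bound : ∀ x ∈ D, ∀ k : ℕ,
    maxPartial k f x ≤ (C : ℝ) ^ k * 2 ^ B * (k.factorial / βmin ^ k)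

/-- `δ' = (δ / 2) (βmin² / (2 d C² 2^B))^(d-1)`, used for `d ≥ 1`. -/
noncomputable def deltaPrime (d B C : ℕ) (βmin δ : ℝ) : ℝ :=
  δ / 2 * (βmin ^ 2 / (2 * d * (C : ℝ) ^ 2 * 2 ^ B)) ^ (d - 1)

/-- `α = min (ε / √d) (δ' βmin³ / (8 d² C³ 2^B))`. -/
noncomputable def alphaRadius (d B C : ℕ) (βmin δ ε : ℝ) : ℝ :=
  min (ε / √(d : ℝ))
    (deltaPrime d B C βmin δ * βmin ^ 3 / (8 * (d : ℝ) ^ 2 * (C : ℝ) ^ 3 * 2 ^ B))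

/-- `ε' = (3 / 16) δ' α`. -/
noncomputable def epsilonPrime (d B C : ℕ) (βmin δ ε : ℝ) : ℝ :=
  3 / 16 * deltaPrime d B C βmin δ * alphaRadius d B C βmin δ ε

/-! Simplified Newton iteration `y ↦ y - A⁻¹ ∇f(y)`, with `A` the transposed Hessian frozen at `x`,
is a `3/4`-contraction of the sup-norm ball of radius `α` about `x`; its fixed point is the critical
point. Cofactor bounds and `|det A| ≥ δ/2` give `‖A⁻¹‖ ≤ 1/δ'`. Third derivatives bound the drift of
the Hessian on the cube by `3δ'/4`, and the first Newton step has length at most `α/4`, so the ball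
is mapped into itself. `exists_critical_point_of_small_gradient` combines these estimates; the main
theorem only checks constants. -/

theorem exists_zero_of_approx_inverse {E : Type*} [NormedAddCommGroup E] [NormedSpace ℝ E]
    [CompleteSpace E] {g : E → E} {g' : E → E →L[ℝ] E} {P : E →L[ℝ] E}
    (hP : Function.Injective P) {x : E} {r c : ℝ} (hr : 0 ≤ r) (hc0 : 0 ≤ c) (hc : c < 1)
    (hg : ∀ y ∈ Metric.closedBall x r, HasFDerivAt g (g' y) y)
    (hb : ∀ y ∈ Metric.closedBall x r, ‖ContinuousLinearMap.id ℝ E - P.comp (g' y)‖ ≤ c)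
    (h0 : ‖P (g x)‖ ≤ (1 - c) * r) :
    ∃ y ∈ Metric.closedBall x r, g y = 0 := by
  have hN : ∀ y ∈ Metric.closedBall x r, ∀ z ∈ Metric.closedBall x r,
      ‖(z - P (g z)) - (y - P (g y))‖ ≤ c * ‖z - y‖ := fun y hy z hz =>
    Convex.norm_image_sub_le_of_norm_hasFDerivWithin_le (𝕜 := ℝ) (f := fun y => y - P (g y))
      (f' := fun y => ContinuousLinearMap.id ℝ E - P.comp (g' y))
      (fun w hw => ((hasFDerivAt_id w).sub (P.hasFDerivAt.comp w (hg w hw))).hasFDerivWithinAt)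
      hb (convex_closedBall x r) hy hz
  have hx : x ∈ Metric.closedBall x r := Metric.mem_closedBall_self hr
  have hmaps : Set.MapsTo (fun y => y - P (g y)) (Metric.closedBall x r)
      (Metric.closedBall x r) := by
    intro y hy
    have h1 := hN x hx y hy
    rw [mem_closedBall_iff_norm] at hy ⊢
    calc ‖y - P (g y) - x‖ = ‖((y - P (g y)) - (x - P (g x))) - P (g x)‖ := by congr 1; abel
      _ ≤ ‖(y - P (g y)) - (x - P (g x))‖ + ‖P (g x)‖ := norm_sub_le _ _
      _ ≤ c * r + (1 - c) * r :=
        add_le_add (h1.trans (mul_le_mul_of_nonneg_left hy hc0)) h0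
      _ = r := by ring
  have hcontr : ContractingWith ⟨c, hc0⟩ (hmaps.restrict _ _ _) := by
    refine ⟨by exact_mod_cast hc, LipschitzWith.of_dist_le_mul fun y z => ?_⟩
    rw [Subtype.dist_eq, Subtype.dist_eq, dist_eq_norm, dist_eq_norm]
    exact hN z z.2 y y.2
  obtain ⟨y, hy, hfix, -⟩ := ContractingWith.exists_fixedPoint'
    Metric.isClosed_closedBall.isComplete hmaps hcontr hx (edist_ne_top _ _)
  -- A fixed point only gives `P (g y) = 0`; injectivity of `P` removes `P`.
  refine ⟨y, hy, hP ?_⟩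
  have : y - P (g y) = y := hfix
  rw [map_zero]
  exact sub_eq_self.mp this

/-! ### Sup-norm bounds for matrices -/

theorem Matrix.norm_mulVec_le_of_row_sum {n : ℕ} {A : Matrix (Fin n) (Fin n) ℝ} {b : ℝ}
    (hb : 0 ≤ b) (hA : ∀ i, ∑ j, |A i j| ≤ b) (v : Fin n → ℝ) : ‖A.mulVec v‖ ≤ b * ‖v‖ := by
  refine (pi_norm_le_iff_of_nonneg (by positivity)).2 fun i => ?_
  calc ‖A.mulVec v i‖ ≤ ∑ j, ‖A i j * v j‖ := norm_sum_le Finset.univ fun j => A i j * v j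
    _ ≤ ∑ j, |A i j| * ‖v‖ := Finset.sum_le_sum fun j _ => by
        rw [norm_mul]; exact mul_le_mul_of_nonneg_left (norm_le_pi_norm v j) (abs_nonneg _)
    _ = (∑ j, |A i j|) * ‖v‖ := (Finset.sum_mul ..).symm
    _ ≤ b * ‖v‖ := by gcongr; exact hA i

theorem Nat.factorial_succ_le_pow (n : ℕ) : (n + 1).factorial ≤ (n + 1) ^ n := by
  induction n with
  | zero => simp
  | succ n ih =>
    rw [Nat.factorial_succ, pow_succ']
    exact Nat.mul_le_mul_left _ (ih.trans (Nat.pow_le_pow_left (by omega) n))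

theorem Matrix.abs_det_le_factorial {n : ℕ} {A : Matrix (Fin n) (Fin n) ℝ} {K : ℝ}
    (hA : ∀ i j, |A i j| ≤ K) : |A.det| ≤ n.factorial * K ^ n := by
  simpa using Matrix.det_le (abv := AbsoluteValue.abs) (A := A) (x := K) hA

/-- Each of the `n + 1` cofactors in a row is at most `n! K^n`. Absorbing `(n + 1)!` into an `n`-th
power yields the exponent `d - 1` in `δ'`. -/
theorem Matrix.sum_abs_adjugate_le {n : ℕ} {A : Matrix (Fin (n + 1)) (Fin (n + 1)) ℝ} {K : ℝ}
    (hK : 0 ≤ K) (hA : ∀ i j, |A i j| ≤ K) (i : Fin (n + 1)) :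
    ∑ j, |A.adjugate i j| ≤ ((n + 1 : ℕ) * K) ^ n := by
  calc ∑ j, |A.adjugate i j| ≤ ∑ _j : Fin (n + 1), n.factorial * K ^ n := by
        refine Finset.sum_le_sum fun j _ => ?_
        rw [Matrix.adjugate_fin_succ_eq_det_submatrix, abs_mul, abs_pow, abs_neg, abs_one,
          one_pow, one_mul]
        exact Matrix.abs_det_le_factorial fun _ _ => hA _ _
    _ = ((n + 1).factorial : ℕ) * K ^ n := by
        simp [Nat.factorial_succ]; ring
    _ ≤ ((n + 1) ^ n : ℕ) * K ^ n := by
        gcongr; exact Nat.factorial_succ_le_pow n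
    _ = ((n + 1 : ℕ) * K) ^ n := by rw [mul_pow, Nat.cast_pow]

/-! ### Partial derivatives in sup-norm coordinates -/

theorem hasFDerivAt_iteratedPartial {d k : ℕ} {f : EuclideanSpace ℝ (Fin d) → ℝ}
    (s : Fin k → Fin d) (w : Fin d → ℝ) (hf : ContDiffAt ℝ ∞ f (WithLp.toLp 2 w)) :
    HasFDerivAt (fun w : Fin d → ℝ => iteratedPartial f s (WithLp.toLp 2 w))
      (∑ i, iteratedPartial f (Fin.cons i s : Fin (k + 1) → Fin d) (WithLp.toLp 2 w) •
        (ContinuousLinearMap.proj i : (Fin d → ℝ) →L[ℝ] ℝ)) w := by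
  have hdiff : DifferentiableAt ℝ (iteratedFDeriv ℝ k f) (WithLp.toLp 2 w) :=
    hf.differentiableAt_iteratedFDeriv (by exact_mod_cast WithTop.coe_lt_top _)
  have h := (hdiff.hasFDerivAt.continuousMultilinear_apply_const
    (fun i => EuclideanSpace.single (s i) (1 : ℝ))).comp w
      (PiLp.hasFDerivAt_toLp (𝕜 := ℝ) 2 w)
  refine h.congr_fderiv ?_
  refine ContinuousLinearMap.coe_injective (LinearMap.pi_ext' fun i => LinearMap.ext_ring ?_)
  have hcons : (Fin.cons (EuclideanSpace.single i (1 : ℝ))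
      (fun l => EuclideanSpace.single (s l) (1 : ℝ)) : Fin (k + 1) → EuclideanSpace ℝ (Fin d)) =
      fun l => EuclideanSpace.single ((Fin.cons i s : Fin (k + 1) → Fin d) l) 1 :=
    funext fun l => by refine Fin.cases ?_ (fun l => ?_) l <;> simp
  have hsucc := iteratedFDeriv_succ_apply_left (𝕜 := ℝ) (f := f) (x := WithLp.toLp 2 w)
    (Fin.cons (EuclideanSpace.single i (1 : ℝ)) fun l => EuclideanSpace.single (s l) (1 : ℝ))
  rw [Fin.cons_zero, Fin.tail_cons, hcons] at hsucc
  simpa [Pi.single_apply, iteratedPartial] using hsucc.symm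

theorem gradient_apply_eq_iteratedPartial {d : ℕ} {f : EuclideanSpace ℝ (Fin d) → ℝ}
    (x : EuclideanSpace ℝ (Fin d)) (j : Fin d) :
    gradient f x j = iteratedPartial f ![j] x := by
  rw [iteratedPartial, iteratedFDeriv_one_apply]
  change _ = fderiv ℝ f x (EuclideanSpace.single j 1)
  rw [← toDual_gradient, InnerProductSpace.toDual_apply_apply,
    EuclideanSpace.inner_single_right]
  simp

theorem abs_iteratedPartial_le_maxPartial {d k : ℕ} (f : EuclideanSpace ℝ (Fin d) → ℝ)
    (s : Fin k → Fin d) (x : EuclideanSpace ℝ (Fin d)) :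
    |iteratedPartial f s x| ≤ maxPartial k f x :=
  le_ciSup (f := fun s : Fin k → Fin d => |iteratedPartial f s x|) (Set.finite_range _).bddAbove s

theorem Matrix.norm_inv_mulVec_le {n : ℕ} {A : Matrix (Fin (n + 1)) (Fin (n + 1)) ℝ} {K m : ℝ}
    (hK : 0 ≤ K) (hA : ∀ i j, |A i j| ≤ K) (hm : 0 < m) (hdet : m ≤ |A.det|)
    (v : Fin (n + 1) → ℝ) : ‖A⁻¹.mulVec v‖ ≤ ((n + 1 : ℕ) * K) ^ n / m * ‖v‖ := by
  refine Matrix.norm_mulVec_le_of_row_sum (by positivity) (fun i => ?_) v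
  have hrow := Matrix.sum_abs_adjugate_le hK hA i
  calc ∑ j, |A⁻¹ i j| = (∑ j, |A.adjugate i j|) / |A.det| := by
        rw [Finset.sum_div]
        refine Finset.sum_congr rfl fun j _ => ?_
        rw [Matrix.inv_def, Ring.inverse_eq_inv', Matrix.smul_apply, smul_eq_mul, abs_mul, abs_inv]
        ring
    _ ≤ ((n + 1 : ℕ) * K) ^ n / m := by gcongr

theorem abs_iteratedPartial_sub_le {d k : ℕ} {f : EuclideanSpace ℝ (Fin d) → ℝ} {x y : Fin d → ℝ}
    {r T : ℝ} (hT : 0 ≤ T)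
    (hf : ∀ w ∈ Metric.closedBall x r, ContDiffAt ℝ ∞ f (WithLp.toLp 2 w))
    (s : Fin k → Fin d)
    (hb : ∀ w ∈ Metric.closedBall x r, ∀ t : Fin (k + 1) → Fin d,
      |iteratedPartial f t (WithLp.toLp 2 w)| ≤ T)
    (hy : y ∈ Metric.closedBall x r) :
    |iteratedPartial f s (WithLp.toLp 2 y) - iteratedPartial f s (WithLp.toLp 2 x)| ≤
      d * T * r := by
  have hr : 0 ≤ r := Metric.nonneg_of_mem_closedBall hy
  have h := Convex.norm_image_sub_le_of_norm_hasFDerivWithin_le (𝕜 := ℝ) (C := d * T)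
    (fun w hw => (hasFDerivAt_iteratedPartial s w (hf w hw)).hasFDerivWithinAt)
    (fun w hw => ?_) (convex_closedBall x r) (Metric.mem_closedBall_self hr) hy
  · refine h.trans ?_
    gcongr
    exact mem_closedBall_iff_norm.1 hy
  · refine ContinuousLinearMap.opNorm_le_bound _ (by positivity) fun v => ?_
    simp only [sum_apply, smul_apply,
      ContinuousLinearMap.proj_apply, smul_eq_mul]
    calc ‖∑ i, iteratedPartial f (Fin.cons i s : Fin (k + 1) → Fin d) (WithLp.toLp 2 w) * v i‖
        ≤ ∑ _i : Fin d, T * ‖v‖ := norm_sum_le_of_le _ fun i _ => by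
          rw [norm_mul]
          exact mul_le_mul (hb w hw _) (norm_le_pi_norm v i) (norm_nonneg _) hT
      _ = d * T * ‖v‖ := by simp [mul_assoc]

/-- The transpose appears because a new differentiation index is put in front; keeping it avoids any
appeal to symmetry of the Hessian. -/
theorem hasFDerivAt_partials {d : ℕ} {f : EuclideanSpace ℝ (Fin d) → ℝ} (w : Fin d → ℝ)
    (hf : ContDiffAt ℝ ∞ f (WithLp.toLp 2 w)) :
    HasFDerivAt (fun (w : Fin d → ℝ) j => iteratedPartial f ![j] (WithLp.toLp 2 w))
      (hessianMatrix f (WithLp.toLp 2 w)).transpose.mulVecLin.toContinuousLinearMap w := by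
  refine hasFDerivAt_pi'.2 fun j => (hasFDerivAt_iteratedPartial ![j] w hf).congr_fderiv ?_
  refine ContinuousLinearMap.ext fun v => ?_
  simp only [sum_apply, smul_apply, ContinuousLinearMap.proj_apply, smul_eq_mul]
  rfl

/-- A Newton-Kantorovich criterion on a cube: an almost critical point at which the Hessian is
bounded away from being singular is close to a critical point. -/
theorem exists_critical_point_of_small_gradient {n : ℕ}
    {f : EuclideanSpace ℝ (Fin (n + 1)) → ℝ} {x : Fin (n + 1) → ℝ} {r K T m σ : ℝ}
    (hr : 0 ≤ r) (hK : 0 ≤ K) (hT : 0 ≤ T) (hm : 0 < m) (hσ : 0 < σ)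
    (hf : ∀ w ∈ Metric.closedBall x r, ContDiffAt ℝ ∞ f (WithLp.toLp 2 w))
    (hH : ∀ i j, |hessianMatrix f (WithLp.toLp 2 x) i j| ≤ K)
    (hb : ∀ w ∈ Metric.closedBall x r, ∀ t : Fin 3 → Fin (n + 1),
      |iteratedPartial f t (WithLp.toLp 2 w)| ≤ T)
    (hdet : m ≤ |(hessianMatrix f (WithLp.toLp 2 x)).det|)
    (hmσ : σ * ((n + 1 : ℕ) * K) ^ n ≤ m)
    (hTr : ((n + 1 : ℕ) : ℝ) ^ 2 * T * r ≤ 3 / 4 * σ)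
    (hgrad : ∀ j, |iteratedPartial f ![j] (WithLp.toLp 2 x)| ≤ 1 / 4 * σ * r) :
    ∃ y ∈ Metric.closedBall x r, gradient f (WithLp.toLp 2 y) = 0 := by
  set A := (hessianMatrix f (WithLp.toLp 2 x)).transpose with hAdef
  have hdetA : A.det = (hessianMatrix f (WithLp.toLp 2 x)).det := Matrix.det_transpose _
  have hunit : IsUnit A.det := by
    rw [hdetA]; exact isUnit_iff_ne_zero.2 (abs_pos.1 (hm.trans_le hdet))
  have hinv : ∀ v, ‖A⁻¹.mulVec v‖ ≤ σ⁻¹ * ‖v‖ := fun v => by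
    refine (Matrix.norm_inv_mulVec_le hK (fun i j => hH j i) hm (hdetA ▸ hdet) v).trans ?_
    gcongr
    rw [div_le_iff₀ hm, inv_mul_eq_div, le_div_iff₀ hσ, mul_comm]
    exact hmσ
  suffices h : ∃ y ∈ Metric.closedBall x r,
      (fun j => iteratedPartial f ![j] (WithLp.toLp 2 y)) = (0 : Fin (n + 1) → ℝ) by
    obtain ⟨y, hy, hy0⟩ := h
    exact ⟨y, hy, by ext j; rw [gradient_apply_eq_iteratedPartial]; exact congrFun hy0 j⟩
  refine exists_zero_of_approx_inverse
    (P := A⁻¹.mulVecLin.toContinuousLinearMap) (c := 3 / 4) (x := x)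
    (g := fun (w : Fin (n + 1) → ℝ) j => iteratedPartial f ![j] (WithLp.toLp 2 w))
    (g' := fun w =>
      (hessianMatrix f (WithLp.toLp 2 w)).transpose.mulVecLin.toContinuousLinearMap)
    (fun v w hvw => by
      have h := congrArg A.mulVec hvw
      simpa [Matrix.mulVec_mulVec, Matrix.mul_nonsing_inv A hunit] using h)
    hr (by norm_num) (by norm_num) (fun w hw => hasFDerivAt_partials w (hf w hw))
    (fun w hw => ?_) ?_
  · refine ContinuousLinearMap.opNorm_le_bound _ (by norm_num) fun v => ?_
    set Aw := (hessianMatrix f (WithLp.toLp 2 w)).transpose with hAw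
    -- `1 - A⁻¹ A_w = A⁻¹ (A - A_w)` turns the contraction estimate into one on Hessian drift.
    have hv : (ContinuousLinearMap.id ℝ (Fin (n + 1) → ℝ) -
        A⁻¹.mulVecLin.toContinuousLinearMap.comp Aw.mulVecLin.toContinuousLinearMap) v =
        A⁻¹.mulVec ((A - Aw).mulVec v) := by
      simp [Matrix.sub_mulVec, Matrix.mulVec_sub, Matrix.mulVec_mulVec,
        Matrix.nonsing_inv_mul A hunit]
    have hdiff : ‖(A - Aw).mulVec v‖ ≤ ((n + 1 : ℕ) : ℝ) ^ 2 * T * r * ‖v‖ := by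
      refine Matrix.norm_mulVec_le_of_row_sum (by positivity) (fun i => ?_) v
      calc ∑ j, |(A - Aw) i j| ≤ ∑ _j : Fin (n + 1), ((n + 1 : ℕ) : ℝ) * T * r :=
            Finset.sum_le_sum fun j _ => by
              rw [Matrix.sub_apply, abs_sub_comm]
              exact abs_iteratedPartial_sub_le hT hf ![j, i] hb hw
        _ = ((n + 1 : ℕ) : ℝ) ^ 2 * T * r := by
          rw [Finset.sum_const, Finset.card_univ, Fintype.card_fin, nsmul_eq_mul]; ring
    rw [hv]
    calc ‖A⁻¹.mulVec ((A - Aw).mulVec v)‖ ≤ σ⁻¹ * (3 / 4 * σ * ‖v‖) :=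
          (hinv _).trans (by gcongr; exact hdiff.trans (by gcongr))
      _ = 3 / 4 * ‖v‖ := by field_simp
  · refine (hinv _).trans ?_
    rw [inv_mul_le_iff₀ hσ]
    refine (pi_norm_le_iff_of_nonneg (by positivity)).2 fun j => (hgrad j).trans (le_of_eq ?_)
    ring

/-! ### Checking the constants -/

theorem deltaPrime_pos {d B C : ℕ} {βmin δ : ℝ} (hd : 0 < d) (hC : 0 < C) (hβ : 0 < βmin)
    (hδ : 0 < δ) : 0 < deltaPrime d B C βmin δ := by
  have : (0 : ℝ) < d := by exact_mod_cast hd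
  have : (0 : ℝ) < C := by exact_mod_cast hC
  unfold deltaPrime
  positivity

theorem lemma4p2 (d : ℕ) (hd : 1 ≤ d)
    (f : EuclideanSpace ℝ (Fin d) → ℝ) (D : Set (EuclideanSpace ℝ (Fin d)))
    (B C : ℕ) (βmin : ℝ) (hf : HasWellBehavedParams f D B C βmin) (hβC : βmin ≤ C)
    (δ ε : ℝ) (hδ : 0 < δ) (hε : 0 < ε)
    -- `f` is `δ`-strongly non-degenerate in its domain
    (hnd : ∃ x₀ ∈ D, gradient f x₀ = 0 ∧ δ ≤ |(hessianMatrix f x₀).det|)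
    (x : EuclideanSpace ℝ (Fin d))
    -- the closed `ℓ_∞` ball of radius `α` around `x` lies in the domain
    (hcube : ∀ y : EuclideanSpace ℝ (Fin d),
      (∀ j, |y j - x j| ≤ alphaRadius d B C βmin δ ε) → y ∈ D)
    -- `‖∇f(x)‖_∞ ≤ ε'` and `|det ∇²f(x)| ≥ δ - ε'`
    (hgrad : ∀ j, |gradient f x j| ≤ epsilonPrime d B C βmin δ ε)
    (hdet : δ - epsilonPrime d B C βmin δ ε ≤ |(hessianMatrix f x).det|) :
    ∃ u : EuclideanSpace ℝ (Fin d),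
      x + u ∈ D ∧ gradient f (x + u) = 0 ∧ (∀ j, |u j| ≤ ε / √(d : ℝ)) ∧ ‖u‖ ≤ ε := by
  obtain ⟨n, rfl⟩ : ∃ n, d = n + 1 := ⟨d - 1, by omega⟩
  obtain ⟨⟨U, hU, hDU, hfU⟩, hC, hβ, hbound⟩ := hf
  have hC0 : (0 : ℝ) < C := by exact_mod_cast hC
  have hd0 : (1 : ℝ) ≤ (n + 1 : ℕ) := by exact_mod_cast hd
  have hσ : 0 < deltaPrime (n + 1) B C βmin δ := deltaPrime_pos hd hC hβ hδ
  set K : ℝ := 2 * C ^ 2 * 2 ^ B / βmin ^ 2 with hKdef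
  set T : ℝ := 6 * C ^ 3 * 2 ^ B / βmin ^ 3 with hTdef
  have hK0 : 0 < K := by positivity
  have hT0 : 0 < T := by positivity
  have hK : ∀ y ∈ D, ∀ i j, |hessianMatrix f y i j| ≤ K := fun y hy i j =>
    (abs_iteratedPartial_le_maxPartial f ![i, j] y).trans
      ((hbound y hy 2).trans_eq (by rw [hKdef]; norm_num [Nat.factorial]; ring))
  have hT : ∀ y ∈ D, ∀ t : Fin 3 → Fin (n + 1), |iteratedPartial f t y| ≤ T := fun y hy t =>
    (abs_iteratedPartial_le_maxPartial f t y).trans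
      ((hbound y hy 3).trans_eq (by rw [hTdef]; norm_num [Nat.factorial]; ring))
  have hσeq : deltaPrime (n + 1) B C βmin δ * ((n + 1 : ℕ) * K) ^ n = δ / 2 := by
    rw [deltaPrime, Nat.add_sub_cancel, mul_assoc, ← mul_pow, hKdef]
    have : βmin ^ 2 / (2 * ((n + 1 : ℕ) : ℝ) * (C : ℝ) ^ 2 * 2 ^ B) *
        ((n + 1 : ℕ) * (2 * C ^ 2 * 2 ^ B / βmin ^ 2)) = 1 := by field_simp
    rw [this, one_pow, mul_one]
  set σ := deltaPrime (n + 1) B C βmin δ with hσdef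
  set r := alphaRadius (n + 1) B C βmin δ ε with hrdef
  have hr0 : 0 < r := by
    rw [hrdef, alphaRadius, ← hσdef]
    exact lt_min (by positivity) (by positivity)
  have hrε : r ≤ ε / √((n + 1 : ℕ) : ℝ) := min_le_left _ _
  have hrσ : r ≤ σ * βmin ^ 3 / (8 * ((n + 1 : ℕ) : ℝ) ^ 2 * (C : ℝ) ^ 3 * 2 ^ B) :=
    min_le_right _ _
  have hTr : ((n + 1 : ℕ) : ℝ) ^ 2 * T * r ≤ 3 / 4 * σ := by
    calc ((n + 1 : ℕ) : ℝ) ^ 2 * T * r ≤ ((n + 1 : ℕ) : ℝ) ^ 2 * T *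
          (σ * βmin ^ 3 / (8 * ((n + 1 : ℕ) : ℝ) ^ 2 * (C : ℝ) ^ 3 * 2 ^ B)) := by gcongr
      _ = 3 / 4 * σ := by rw [hTdef]; field_simp; norm_num
  have hKone : 1 ≤ K := by
    rw [hKdef, le_div_iff₀ (by positivity), one_mul]
    have h1 : βmin ^ 2 ≤ (C : ℝ) ^ 2 := by gcongr
    have h2 : (1 : ℝ) ≤ 2 ^ B := one_le_pow₀ (by norm_num)
    nlinarith [pow_pos hC0 2]
  have hdK : 1 ≤ ((n + 1 : ℕ) : ℝ) * K := one_le_mul_of_one_le_of_one_le hd0 hKone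
  have hσδ : σ ≤ δ / 2 := by
    rw [← hσeq]; exact le_mul_of_one_le_right hσ.le (one_le_pow₀ hdK)
  -- Non-degeneracy enters only here: a point with `|det| ≥ δ` forces `δ ≤ d! K^d`, which caps `δ'`
  -- and hence, below, `α`.
  have hσK : σ ≤ K / 2 := by
    obtain ⟨x₀, hx₀, -, hx₀det⟩ := hnd
    have h1 : δ ≤ (((n + 1 : ℕ) : ℝ) * K) ^ n * K := by
      refine (hx₀det.trans (Matrix.abs_det_le_factorial (hK x₀ hx₀))).trans ?_
      have : ((n + 1).factorial : ℝ) ≤ ((n + 1 : ℕ) : ℝ) ^ n := by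
        exact_mod_cast Nat.factorial_succ_le_pow n
      rw [mul_pow, pow_succ, mul_assoc]
      gcongr
    have h2 : (0 : ℝ) < (((n + 1 : ℕ) : ℝ) * K) ^ n := by positivity
    nlinarith
  have hr8 : r ≤ 1 / 8 := by
    refine hrσ.trans ?_
    rw [div_le_iff₀ (by positivity)]
    have h1 : σ * βmin ^ 2 ≤ (C : ℝ) ^ 2 * 2 ^ B := by
      calc σ * βmin ^ 2 ≤ K / 2 * βmin ^ 2 := by gcongr
        _ = (C : ℝ) ^ 2 * 2 ^ B := by rw [hKdef]; field_simp
    calc σ * βmin ^ 3 = σ * βmin ^ 2 * βmin := by ring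
      _ ≤ (C : ℝ) ^ 2 * 2 ^ B * C := by gcongr
      _ ≤ (C : ℝ) ^ 2 * 2 ^ B * C * ((n + 1 : ℕ) : ℝ) ^ 2 :=
        le_mul_of_one_le_right (by positivity) (one_le_pow₀ hd0)
      _ = 1 / 8 * (8 * ((n + 1 : ℕ) : ℝ) ^ 2 * (C : ℝ) ^ 3 * 2 ^ B) := by ring
  have hε' : epsilonPrime (n + 1) B C βmin δ ε = 3 / 16 * σ * r := rfl
  have hmem : ∀ w ∈ Metric.closedBall x.ofLp r, WithLp.toLp 2 w ∈ D := fun w hw =>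
    hcube _ fun j => (dist_pi_le_iff hr0.le).1 hw j
  obtain ⟨y, hy, hy0⟩ := exists_critical_point_of_small_gradient (f := f) (x := x.ofLp)
    (m := δ / 2) hr0.le hK0.le hT0.le (by positivity) hσ
    (fun w hw => hfU.contDiffAt (hU.mem_nhds (hDU (hmem w hw))))
    (hK x (hmem _ (Metric.mem_closedBall_self hr0.le)))
    (fun w hw => hT _ (hmem w hw))
    -- `σ ≤ δ/2` and `r ≤ 1/8` give `ε' ≤ δ/2`, so the determinant at `x` is at least `δ/2`.
    (le_trans (by rw [hε']; nlinarith) hdet) hσeq.le hTr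
    (fun j => by
      rw [← gradient_apply_eq_iteratedPartial]
      exact (hgrad j).trans (by rw [hε']; nlinarith))
  have hu : ∀ j, |(WithLp.toLp 2 y - x) j| ≤ ε / √((n + 1 : ℕ) : ℝ) := fun j =>
    ((dist_pi_le_iff hr0.le).1 hy j).trans hrε
  refine ⟨WithLp.toLp 2 y - x, ?_, ?_, hu, ?_⟩
  · rw [add_sub_cancel]; exact hmem y hy
  · rw [add_sub_cancel]; exact hy0
  · rw [EuclideanSpace.norm_eq]
    refine Real.sqrt_le_iff.2 ⟨hε.le, ?_⟩
    calc ∑ j, ‖(WithLp.toLp 2 y - x) j‖ ^ 2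
        ≤ ∑ _j : Fin (n + 1), (ε / √((n + 1 : ℕ) : ℝ)) ^ 2 :=
          Finset.sum_le_sum fun j _ => by gcongr; exact hu j
      _ = ε ^ 2 := by
        rw [Finset.sum_const, Finset.card_univ, Fintype.card_fin, nsmul_eq_mul, div_pow,
          Real.sq_sqrt (by positivity)]
        field_simp
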